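/- Let $G$ be a circle graph, i.e. a finite simple graph for which there are a finite 4-regular graph $F$ (loops and multiple edges allowed) with $V(F)=V(G)$ and an Euler system $C$ of $F$ (a choice of one Eulerian circuit for each connected component of $F$) such that two distinct vertices $u,v$ are adjacent in $G$ if and only if they lie in the same component of $F$ and the Eulerian circuit of that component visits them in the cyclic order $u,v,u,v$. Let $\mathrm{IAS}(G)=(I\;\;A(G)\;\;I+A(G))$ over $GF(2)$, where $A(G)$ is the adjacency matrix. Let $U$ be the set of its $3|V(G)|$ column indices, partitioned into the vertex triples (for each vertex $v$, the indices of the $v$-columns of $I$, $A(G)$ and $I+A(G)$). A transversal is a subset of $U$ that contains exactly one element of each triple, and a subtransversal is a subset of a transversal. Let $\mathcal{Z}_3(G)$ be the 3-matroid on $U$ whose skew classes are the vertex triples and in which the rank $r(S)$ of a subtransversal $S$ is the $GF(2)$-rank of the submatrix of $\mathrm{IAS}(G)$ formed by the columns in $S$. Then $\mathcal{Z}_3(G)$ has a strict, totally transversally unimodular representation. That is, there is a matrix $A$ over $\mathbb{Q}$, with finitely many rows and with columns indexed by $U$, such that: 1. (representation) for every subtransversal $S$, the $\mathbb{Q}$-rank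 of the columns of $A$ in $S$ equals $r(S)$; equivalently, the matroid on $U$ represented by $A$ over $\mathbb{Q}$ shelters $\mathcal{Z}_3(G)$; 2. (strictness) the rank of $A$ equals the maximum of $r(S)$ over all subtransversals $S$; 3. (total transversal unimodularity) every square submatrix of $A$ whose column indices form a subtransversal has determinant in $\{-1,0,1\}$. -/

import Mathlib

/-! ### Graphs, circuits, Euler systems and interlacement -/

/-- A graph (loops and multiple edges allowed) with vertices `V`, half-edges `H` and incidence
function `ε : H → V`. The partition of `H` into unordered pairs (the edges) is given by the
fixed-point-free involution `mate`: the edges are the sets `{h, mate h}`. -/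
structure HalfEdgeGraph (V H : Type*) where
  ε : H → V
  mate : H → H
  mate_mate : ∀ h, mate (mate h) = h
  mate_ne : ∀ h, mate h ≠ h

namespace HalfEdgeGraph

variable {V H : Type*} (F : HalfEdgeGraph V H)

/-- Every vertex is incident to exactly four half-edges. -/
def IsFourRegular : Prop := ∀ v : V, {h : H | F.ε h = v}.ncard = 4

/-- The connected components of a graph: the quotient of the vertex set by the equivalence
relation generated by "joined by an edge". -/
def Component : Type _ := Quot fun u v : V => ∃ h, F.ε h = u ∧ F.ε (F.mate h) = v

/-- The connected component of a vertex. -/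
def component (v : V) : F.Component := Quot.mk _ v

/-- The half-edges occurring in a list of directed single transitions. -/
def halfEdges (W : List (H × H)) : List H := W.flatMap fun p => [p.1, p.2]

/-- `W`, a list of directed single transitions read cyclically, is an oriented circuit: it is
nonempty, the two half-edges of each `(h, h')` in `W` meet at a vertex, for cyclically consecutive
`(h₁, h₂), (h₃, h₄)` in `W` the pair `{h₂, h₃}` is an edge, and no half-edge occurs twice. -/
structure IsOrientedCircuit (W : List (H × H)) : Prop where
  ne_nil : W ≠ []
  transition : ∀ p ∈ W, F.ε p.1 = F.ε p.2
  edge : Cycle.Chain (fun p q : H × H => F.mate p.2 = q.1) (W : Cycle (H × H))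
  nodup : (halfEdges W).Nodup

/-- The vertices visited by `W`, in order. -/
def visits (W : List (H × H)) : List V := W.map fun p => F.ε p.1

/-- An Euler system: for each connected component, one Eulerian circuit of that component, that is,
a circuit containing exactly the half-edges of that component. Each circuit is given by a
representative closed walk (a choice of orientation and starting point). -/
structure EulerSystem where
  circuit : F.Component → List (H × H)
  isOrientedCircuit : ∀ c, F.IsOrientedCircuit (circuit c)
  eulerian : ∀ c h, h ∈ halfEdges (circuit c) ↔ F.component (F.ε h) = c

variable {F}

/-- Distinct vertices `u`, `v` are interlaced with respect to `C` if they lie in the same component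
and the Eulerian circuit of that component visits them in the order `u, v, u, v` or
`v, u, v, u`. -/
def EulerSystem.Interlaced (C : F.EulerSystem) (u v : V) : Prop :=
  u ≠ v ∧ F.component u = F.component v ∧
    ([u, v, u, v].Sublist (F.visits (C.circuit (F.component u))) ∨
      [v, u, v, u].Sublist (F.visits (C.circuit (F.component u))))

end HalfEdgeGraph

/-- A circle graph is the interlacement graph of some (finite) 4-regular graph with respect to some
Euler system. (The finite set of half-edges may be taken in `Type` without loss of generality.) -/
def IsCircleGraph {V : Type*} (G : SimpleGraph V) : Prop :=
  ∃ (H : Type) (_ : Finite H) (F : HalfEdgeGraph V H) (C : F.EulerSystem),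
    F.IsFourRegular ∧ ∀ u v, G.Adj u v ↔ C.Interlaced u v

/-! ### The matroid represented by a matrix -/

/-- The matroid on the set of column indices represented by the matrix `A`: a set is independent if
and only if the corresponding columns are linearly independent. -/
def vectorMatroid {X U K : Type*} [Finite U] [Field K] (A : Matrix X U K) : Matroid U :=
  (IndepMatroid.ofFinite (E := Set.univ) Set.finite_univ
    (Indep := fun I => LinearIndepOn K A.col I)
    (indep_empty := linearIndepOn_empty K _)
    (indep_subset := fun _ _ hJ hIJ => hJ.mono hIJ)
    (indep_aug := by
      intro I J hI hJ hlt
      by_contra! hcon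
      have hsub : A.col '' J ⊆ Submodule.span K (A.col '' I) := by
        rintro _ ⟨j, hj, rfl⟩
        by_cases hjI : j ∈ I
        · exact Submodule.subset_span ⟨j, hjI, rfl⟩
        · by_contra hns
          exact hcon j hj hjI ((linearIndepOn_insert hjI).2 ⟨hI, hns⟩)
      have hfin : (A.col '' I).Finite := Set.toFinite _
      have : Module.Finite K (Submodule.span K (A.col '' I)) :=
        Module.Finite.span_of_finite K hfin
      have h1 : Module.finrank K (Submodule.span K (A.col '' J)) ≤
          Module.finrank K (Submodule.span K (A.col '' I)) :=
        Submodule.finrank_mono (Submodule.span_le.2 hsub)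
      have key : ∀ L : Set U, LinearIndepOn K A.col L →
          Module.finrank K (Submodule.span K (A.col '' L)) = L.ncard := by
        intro L hL
        have := Fintype.ofFinite L
        have h := finrank_span_eq_card hL
        rw [← Set.image_eq_range] at h
        rw [h, Set.ncard_eq_toFinset_card', Set.toFinset_card]
      rw [key J hJ, key I hI] at h1
      omega)
    (subset_ground := fun _ _ => Set.subset_univ _)).matroid

/-! ### Multimatroids -/

/-- A transversal of `Ω` contains precisely one element of every member of `Ω`. -/
def IsTransversal {U : Type*} (Ω : Set (Set U)) (T : Set U) : Prop :=
  ∀ ω ∈ Ω, ∃! x, x ∈ T ∧ x ∈ ω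

/-- A subtransversal of `Ω` is a subset of a transversal. -/
def IsSubtransversal {U : Type*} (Ω : Set (Set U)) (S : Set U) : Prop :=
  ∃ T, IsTransversal Ω T ∧ S ⊆ T

theorem IsSubtransversal.subset {U : Type*} {Ω : Set (Set U)} {S X : Set U}
    (hS : IsSubtransversal Ω S) (hX : X ⊆ S) : IsSubtransversal Ω X := by
  obtain ⟨T, hT, hST⟩ := hS
  exact ⟨T, hT, hX.trans hST⟩

theorem IsSubtransversal.insert_of_disjoint {U : Type*} {Ω : Set (Set U)} (hΩ : Setoid.IsPartition Ω)
    {S ω : Set U} {x : U} (hS : IsSubtransversal Ω S) (hω : ω ∈ Ω) (hd : Disjoint S ω)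
    (hx : x ∈ ω) : IsSubtransversal Ω (insert x S) := by
  obtain ⟨T, hT, hST⟩ := hS
  refine ⟨insert x (T \ ω), ?_, ?_⟩
  · intro ω' hω'
    by_cases h : ω' = ω
    · subst h
      refine ⟨x, ⟨by simp, hx⟩, ?_⟩
      rintro y ⟨hy | hy, hy'⟩
      · exact hy
      · exact absurd hy' hy.2
    · have hdis : Disjoint ω' ω := hΩ.pairwiseDisjoint hω' hω h
      obtain ⟨y, ⟨hy, hy'⟩, huniq⟩ := hT ω' hω'
      refine ⟨y, ⟨Or.inr ⟨hy, fun h' => Set.disjoint_left.1 hdis hy' h'⟩, hy'⟩, ?_⟩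
      rintro z ⟨hz | hz, hz'⟩
      · subst hz
        exact absurd hx (Set.disjoint_left.1 hdis hz')
      · exact huniq z ⟨hz.1, hz'⟩
  · rintro y (hy | hy)
    · exact Or.inl hy
    · exact Or.inr ⟨hST hy, Set.disjoint_left.1 hd hy⟩

/-- A multimatroid on a finite set `U`, described by its rank function. -/
structure Multimatroid (U : Type*) [Finite U] where
  /-- the skew classes -/
  Ω : Set (Set U)
  isPartition : Setoid.IsPartition Ω
  /-- the rank function, defined on the subtransversals of `Ω` -/
  r : {S : Set U // IsSubtransversal Ω S} → ℕ
  /-- for each subtransversal `S`, the restriction of `r` to the subsets of `S` is the rank function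
  of a matroid on `S` -/
  matroid : ∀ (S : Set U) (hS : IsSubtransversal Ω S), ∃ M : Matroid U, M.E = S ∧
    ∀ (X : Set U) (hX : X ⊆ S), M.eRk X = r ⟨X, hS.subset hX⟩
  skew : ∀ (S : Set U) (hS : IsSubtransversal Ω S) (ω : Set U) (hω : ω ∈ Ω) (hd : Disjoint S ω)
    (x y : U) (hx : x ∈ ω) (hy : y ∈ ω), x ≠ y →
    r ⟨S, hS⟩ < max (r ⟨insert x S, hS.insert_of_disjoint isPartition hω hd hx⟩)
      (r ⟨insert y S, hS.insert_of_disjoint isPartition hω hd hy⟩)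

namespace Multimatroid

variable {U : Type*} [Finite U] (Z : Multimatroid U)

/-- A `k`-matroid is a multimatroid in which every skew class has exactly `k` elements. -/
def IsKMatroid (k : ℕ) : Prop := ∀ ω ∈ Z.Ω, ω.ncard = k

/-- `Z` is sheltered by `M`: `M` is a matroid on `U` whose rank function restricts to that
of `Z`. -/
def IsShelteredBy (M : Matroid U) : Prop :=
  M.E = Set.univ ∧ ∀ S : {S : Set U // IsSubtransversal Z.Ω S}, M.eRk S.1 = Z.r S

/-- `M` is a strict sheltering matroid for `Z`: moreover, the rank of `M` is the maximum value of
the rank function of `Z`. -/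
def IsStrictlyShelteredBy (M : Matroid U) : Prop :=
  Z.IsShelteredBy M ∧ IsGreatest (Set.range fun S => (Z.r S : ℕ∞)) M.eRank

/-- The matrix `A` over `K` is a `K`-representation of `Z`, i.e. a `K`-representation of some
sheltering matroid for `Z`. -/
def IsRepresentation {X K : Type*} [Field K] (A : Matrix X U K) : Prop :=
  Z.IsShelteredBy (vectorMatroid A)

/-- The matrix `A` over `K` is a strict `K`-representation of `Z`, i.e. a `K`-representation of
some strict sheltering matroid for `Z`. -/
def IsStrictRepresentation {X K : Type*} [Field K] (A : Matrix X U K) : Prop :=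
  Z.IsStrictlyShelteredBy (vectorMatroid A)

/-- Every square submatrix of `A` whose column indices form a subtransversal has determinant in
`{-1, 0, 1}`. -/
def IsTotallyTransversallyUnimodular {X R : Type*} [CommRing R] (A : Matrix X U R) : Prop :=
  ∀ S : Set U, IsSubtransversal Z.Ω S →
    (A.submatrix id ((↑) : S → U)).IsTotallyUnimodular

end Multimatroid

/-! ### The isotropic matroid and the 3-matroid of a graph -/

section Isotropic

variable {V : Type*} [Fintype V] [DecidableEq V] (G : SimpleGraph V) [DecidableRel G.Adj]

/-- The matrix `IAS(G) = (I  A(G)  I + A(G))` over `GF(2)`. Its columns are indexed by three copies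
of the vertex set. -/
def IAS : Matrix V (V ⊕ V ⊕ V) (ZMod 2) :=
  Matrix.fromCols 1 (Matrix.fromCols (G.adjMatrix (ZMod 2)) (1 + G.adjMatrix (ZMod 2)))

/-- The vertex triple of `v`: the indices of the `v`-columns of `I`, `A(G)` and `I + A(G)`. -/
def vertexTriple {V : Type*} (v : V) : Set (V ⊕ V ⊕ V) :=
  {Sum.inl v, Sum.inr (Sum.inl v), Sum.inr (Sum.inr v)}

/-- The partition of the set of column indices of `IAS(G)` into vertex triples. -/
def vertexTriples (V : Type*) : Set (Set (V ⊕ V ⊕ V)) := Set.range vertexTriple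

theorem vertexTriples_isPartition (V : Type*) : Setoid.IsPartition (vertexTriples V) := by
  constructor
  · rintro ⟨v, hv⟩
    have : (Sum.inl v : V ⊕ V ⊕ V) ∈ vertexTriple v := by simp [vertexTriple]
    rw [hv] at this
    exact this
  · rintro (v | v | v) <;>
    · refine ⟨vertexTriple v, ⟨⟨v, rfl⟩, by simp [vertexTriple]⟩, ?_⟩
      rintro _ ⟨⟨w, rfl⟩, hw⟩
      simp only [vertexTriple, Set.mem_insert_iff, Set.mem_singleton_iff, Sum.inl.injEq,
        Sum.inr.injEq, reduceCtorEq, or_false, false_or] at hw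
      rw [hw]

open Classical in
/-- The `GF(2)`-rank of the submatrix of `IAS(G)` induced by the columns indexed by `S`. -/
noncomputable def rankIAS (S : Set (V ⊕ V ⊕ V)) : ℕ :=
  ((IAS G).submatrix id ((↑) : S → V ⊕ V ⊕ V)).rank

theorem rankIAS_eq (S : Set (V ⊕ V ⊕ V)) :
    rankIAS G S = Module.finrank (ZMod 2) (Submodule.span (ZMod 2) ((IAS G).col '' S)) := by
  classical
  rw [rankIAS, Matrix.rank_eq_finrank_span_cols, Set.image_eq_range]
  rfl

theorem eRk_vectorMatroid_IAS (S : Set (V ⊕ V ⊕ V)) :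
    (vectorMatroid (IAS G)).eRk S = rankIAS G S := by
  obtain ⟨I, hI⟩ := (vectorMatroid (IAS G)).exists_isBasis S (Set.subset_univ _)
  have hIi : LinearIndepOn (ZMod 2) (IAS G).col I := hI.indep
  rw [← hI.encard_eq_eRk, rankIAS_eq]
  have hspan : Submodule.span (ZMod 2) ((IAS G).col '' S) =
      Submodule.span (ZMod 2) ((IAS G).col '' I) := by
    refine le_antisymm (Submodule.span_le.2 ?_)
      (Submodule.span_mono (Set.image_mono hI.subset))
    rintro _ ⟨j, hj, rfl⟩
    by_cases hjI : j ∈ I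
    · exact Submodule.subset_span ⟨j, hjI, rfl⟩
    · by_contra hns
      have hins : (vectorMatroid (IAS G)).Indep (insert j I) :=
        (linearIndepOn_insert hjI).2 ⟨hIi, hns⟩
      exact hjI (hI.mem_of_insert_indep hj hins)
  rw [hspan]
  have := Fintype.ofFinite I
  have h := finrank_span_eq_card hIi
  rw [← Set.image_eq_range] at h
  rw [h, Set.encard_eq_coe_toFinset_card, Set.toFinset_card]

theorem mem_span_of_rankIAS_insert_le {S : Set (V ⊕ V ⊕ V)} {x : V ⊕ V ⊕ V}
    (h : rankIAS G (insert x S) ≤ rankIAS G S) :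
    (IAS G).col x ∈ Submodule.span (ZMod 2) ((IAS G).col '' S) := by
  rw [rankIAS_eq, rankIAS_eq] at h
  have := Submodule.eq_of_le_of_finrank_le
    (Submodule.span_mono (Set.image_mono (Set.subset_insert x S))) h
  rw [this]
  exact Submodule.subset_span ⟨x, Set.mem_insert _ _, rfl⟩

/-- A linear combination of columns of `IAS(G)`, in terms of `A(G)`. -/
theorem exists_coeff_of_mem_span {S : Set (V ⊕ V ⊕ V)} {z : V → ZMod 2}
    (h : z ∈ Submodule.span (ZMod 2) ((IAS G).col '' S)) :
    ∃ f : V ⊕ V ⊕ V → ZMod 2, (∀ x, x ∉ S → f x = 0) ∧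
      z = (fun w => f (.inl w) + f (.inr (.inr w))) +
        (G.adjMatrix (ZMod 2)).mulVec (fun w => f (.inr (.inl w)) + f (.inr (.inr w))) := by
  obtain ⟨l, hl, rfl⟩ := (Finsupp.mem_span_image_iff_linearCombination (ZMod 2)).1 h
  refine ⟨l, fun x hx => ?_, ?_⟩
  · by_contra hne
    exact hx (hl (Finsupp.mem_support_iff.2 hne))
  · have h1 : Finsupp.linearCombination (ZMod 2) (IAS G).col l = (IAS G).mulVec l := by
      ext i
      rw [Finsupp.linearCombination_apply, Finsupp.sum_fintype _ _ (by simp)]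
      simp [Matrix.mulVec, dotProduct, Finset.sum_apply, Matrix.col, mul_comm]
    rw [h1]
    have h2 : (l : V ⊕ V ⊕ V → ZMod 2) =
        Sum.elim (fun w => l (.inl w))
          (Sum.elim (fun w => l (.inr (.inl w))) (fun w => l (.inr (.inr w)))) := by
      ext (x | x | x) <;> rfl
    rw [h2, IAS, Matrix.fromCols_mulVec_sumElim, Matrix.fromCols_mulVec_sumElim,
      Matrix.add_mulVec, Matrix.one_mulVec, Matrix.one_mulVec]
    have h3 : (fun w => l (.inr (.inl w)) + l (.inr (.inr w))) =
      (fun w => l (.inr (.inl w))) + (fun w => l (.inr (.inr w))) := rfl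
    have h4 : (fun w => l (.inl w) + l (.inr (.inr w))) =
      (fun w => l (.inl w)) + (fun w => l (.inr (.inr w))) := rfl
    simp only [Sum.elim_inl, Sum.elim_inr]
    rw [h3, h4, Matrix.mulVec_add]
    abel

theorem rankIAS_skew {S ω : Set (V ⊕ V ⊕ V)} (hS : IsSubtransversal (vertexTriples V) S)
    (hω : ω ∈ vertexTriples V) (hd : Disjoint S ω) {x y : V ⊕ V ⊕ V} (hx : x ∈ ω) (hy : y ∈ ω)
    (hxy : x ≠ y) : rankIAS G S < max (rankIAS G (insert x S)) (rankIAS G (insert y S)) := by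
  by_contra! hcon
  obtain ⟨v, rfl⟩ := hω
  have hmx := mem_span_of_rankIAS_insert_le G ((le_max_left _ _).trans hcon)
  have hmy := mem_span_of_rankIAS_insert_le G ((le_max_right _ _).trans hcon)
  set W := Submodule.span (ZMod 2) ((IAS G).col '' S) with hW
  have c1 : (IAS G).col (.inl v) = Pi.single v 1 := by
    ext i
    simp [IAS, Matrix.col, Matrix.one_apply, Pi.single_apply]
  have c2 : (IAS G).col (.inr (.inl v)) = (G.adjMatrix (ZMod 2)).mulVec (Pi.single v 1) := by
    ext i
    simp [IAS, Matrix.col]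
  have c3 : (IAS G).col (.inr (.inr v)) =
      (IAS G).col (.inl v) + (IAS G).col (.inr (.inl v)) := by
    ext i
    simp [IAS, Matrix.col]
  have two : ∀ a : V → ZMod 2, a + a = 0 := fun a => by
    ext i
    exact CharTwo.add_self_eq_zero _
  have e13 : (IAS G).col (.inr (.inl v)) =
      (IAS G).col (.inl v) + (IAS G).col (.inr (.inr v)) := by
    rw [c3, ← add_assoc, two, zero_add]
  have e23 : (IAS G).col (.inl v) =
      (IAS G).col (.inr (.inl v)) + (IAS G).col (.inr (.inr v)) := by
    rw [c3, add_left_comm, two, add_zero]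
  have hboth : (IAS G).col (.inl v) ∈ W ∧ (IAS G).col (.inr (.inl v)) ∈ W := by
    simp only [vertexTriple, Set.mem_insert_iff, Set.mem_singleton_iff] at hx hy
    rcases hx with rfl | rfl | rfl <;> rcases hy with rfl | rfl | rfl
    · exact absurd rfl hxy
    · exact ⟨hmx, hmy⟩
    · exact ⟨hmx, e13 ▸ W.add_mem hmx hmy⟩
    · exact ⟨hmy, hmx⟩
    · exact absurd rfl hxy
    · exact ⟨e23 ▸ W.add_mem hmx hmy, hmx⟩
    · exact ⟨hmy, e13 ▸ W.add_mem hmy hmx⟩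
    · exact ⟨e23 ▸ W.add_mem hmy hmx, hmy⟩
    · exact absurd rfl hxy
  obtain ⟨h1, h2⟩ := hboth
  rw [c1] at h1
  rw [c2] at h2
  obtain ⟨f, hf, hfe⟩ := exists_coeff_of_mem_span G h1
  obtain ⟨g, hg, hge⟩ := exists_coeff_of_mem_span G h2
  have hnot : ∀ u ∈ vertexTriple v, u ∉ S := fun u hu huS => Set.disjoint_left.1 hd huS hu
  have n1 := hnot (.inl v) (by simp [vertexTriple])
  have n2 := hnot (.inr (.inl v)) (by simp [vertexTriple])
  have n3 := hnot (.inr (.inr v)) (by simp [vertexTriple])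
  set A := G.adjMatrix (ZMod 2) with hA
  set pf : V → ZMod 2 := fun w => f (.inl w) + f (.inr (.inr w)) with hpf
  set qf : V → ZMod 2 := fun w => f (.inr (.inl w)) + f (.inr (.inr w)) with hqf
  set pg : V → ZMod 2 := fun w => g (.inl w) + g (.inr (.inr w)) with hpg
  set qg : V → ZMod 2 := fun w => g (.inr (.inl w)) + g (.inr (.inr w)) with hqg
  have k1 : A.mulVec qf = Pi.single v 1 + pf := by
    rw [hfe, add_right_comm, two, zero_add]
  have k2 : A.mulVec (qg + Pi.single v 1) = pg := by
    rw [Matrix.mulVec_add, hge, add_comm pg, ← add_assoc, two, zero_add]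
  have hsymm : A.transpose = A := SimpleGraph.transpose_adjMatrix _
  have k3 : dotProduct (qg + Pi.single v 1) (A.mulVec qf) =
      dotProduct qf (A.mulVec (qg + Pi.single v 1)) := by
    rw [Matrix.dotProduct_mulVec, ← Matrix.mulVec_transpose, hsymm, dotProduct_comm]
  have pf0 : pf v = 0 := by simp [hpf, hf _ n1, hf _ n3]
  have qg0 : qg v = 0 := by simp [hqg, hg _ n2, hg _ n3]
  rw [k1, k2] at k3
  simp only [add_dotProduct, dotProduct_add, dotProduct_single, single_dotProduct, pf0,
    Pi.add_apply, Pi.single_eq_same, mul_one, one_mul, add_zero] at k3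
  have k4 : dotProduct qg pf = dotProduct qf pg := by
    refine Finset.sum_congr rfl fun w _ => ?_
    obtain ⟨T, hT, hST⟩ := hS
    obtain ⟨u, ⟨_, _⟩, huniq⟩ := hT _ ⟨w, rfl⟩
    have hz : ∀ t ∈ vertexTriple w, t ≠ u → f t = 0 ∧ g t = 0 := by
      intro t ht htu
      have : t ∉ S := fun hs => htu (huniq t ⟨hST hs, ht⟩)
      exact ⟨hf t this, hg t this⟩
    have z1 := hz (.inl w) (by simp [vertexTriple])
    have z2 := hz (.inr (.inl w)) (by simp [vertexTriple])
    have z3 := hz (.inr (.inr w)) (by simp [vertexTriple])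
    simp only [hpf, hqf, hpg, hqg]
    by_cases u1 : Sum.inl w = u
    · have a2 := z2 (by rw [← u1]; simp)
      have a3 := z3 (by rw [← u1]; simp)
      simp [a2, a3]
    · have a1 := z1 u1
      by_cases u2 : Sum.inr (Sum.inl w) = u
      · have a3 := z3 (by rw [← u2]; simp)
        simp [a1, a3]
      · have a2 := z2 u2
        simp [a1, a2, mul_comm]
  rw [k4, qg0] at k3
  simp at k3

/-- The 3-matroid `𝒵₃(G)`: its ground set is the set of column indices of `IAS(G)`, its skew
classes are the vertex triples, and the rank of a subtransversal `S` is the `GF(2)`-rank of the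
submatrix of `IAS(G)` induced by the columns indexed by `S`. -/
noncomputable def Z₃ : Multimatroid (V ⊕ V ⊕ V) where
  Ω := vertexTriples V
  isPartition := vertexTriples_isPartition V
  r := fun S => rankIAS G S.1
  matroid := fun S _ => ⟨(vectorMatroid (IAS G)).restrict S, rfl, fun X hX => by
    rw [Matroid.eRk, Matroid.restrict_restrict_eq _ hX, Matroid.eRank_restrict,
      eRk_vectorMatroid_IAS]⟩
  skew := fun _ hS _ hω hd _ _ hx hy hxy => rankIAS_skew G hS hω hd hx hy hxy

/-- `𝒵₃(G)` is indeed a 3-matroid. -/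
theorem Z₃_isKMatroid : (Z₃ G).IsKMatroid 3 := by
  rintro _ ⟨v, rfl⟩
  exact Set.ncard_eq_three.2 ⟨_, _, _, by simp, by simp, by simp, rfl⟩

end Isotropic

/-! Writing the Euler circuits of the components one after the other gives a single cyclic word in
which every vertex occurs twice, with unchanged interlacement. Read this word as an Eulerian circuit
of a directed graph with one vertex per letter and one edge entering each position. The arc from the
first to the second occurrence of `u` is a circulation, its chord, and the combinations of chords
are exactly the circulations vanishing on the edge that enters position 0 (`flow_succ`, `eq_flow`).
Each of the three transitions at `v` splits `v` into two halves; recording the net inflow of every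
chord into one half gives an integer column. Modulo 2 the three columns of `v` are those of `I`,
`A(G)` and `I + A(G)` (`map_netMatrix`).

Let `N` be the matrix of chord values on the edges entering second occurrences. It is triangular
with unit diagonal in a suitable order, and the representation is the inverse of `N` times the
matrix of net inflows. Up to sign, a minor of it on a subtransversal is the determinant of `N` with
some columns replaced by net-inflow columns (`det_replace_columns`). Over a field this determinant
is nonzero if and only if no nonzero circulation survives after certain vertices are split and
certain edges deleted, that is, if and only if the remaining graph is a forest
(`forall_flow_eq_zero_iff`). Since this does not depend on the field, no prime divides a nonzero
minor, so all such minors are 0, 1 or -1.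

Such unimodularity makes independence of the columns in a subtransversal the same over `ℚ` as over
`GF(2)`, where `N` is still invertible and the ranks are those of `IAS(G)`. -/

/-! ### Linear algebra -/

/-- The flows of a finite directed graph over a field vanish if and only if the graph is a forest;
this condition does not depend on the field. -/
theorem forall_flow_eq_zero_iff {E W K : Type*} [Fintype E] [Fintype W] [DecidableEq W] [Field K]
    (s t : E → W) :
    (∀ x : E → K, (∀ w, ∑ e, ((if t e = w then x e else 0) - if s e = w then x e else 0) = 0) →
      x = 0) ↔
    Nat.card E + Nat.card (Quot fun a b => ∃ e, s e = a ∧ t e = b) = Nat.card W := by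
  classical
  set rel : W → W → Prop := fun a b => ∃ e, s e = a ∧ t e = b with hrel
  -- Oriented incidence matrix: its left kernel consists of the flows, its right kernel of the
  -- functions constant on components. Rank-nullity then compares the two.
  let M : Matrix E W K := Matrix.of fun e w => (if t e = w then 1 else 0) - if s e = w then 1 else 0
  have hvec : ∀ (x : E → K) w, Matrix.vecMul x M w =
      ∑ e, ((if t e = w then x e else 0) - if s e = w then x e else 0) := by
    intro x w
    simp [M, Matrix.vecMul, dotProduct, mul_sub]
  have hmul : ∀ (y : W → K) e, M.mulVec y e = y (t e) - y (s e) := by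
    intro y e
    simp [M, Matrix.mulVec, dotProduct, sub_mul, Finset.sum_sub_distrib]
  have h1 : (∀ x : E → K, (∀ w, ∑ e, ((if t e = w then x e else 0) -
      if s e = w then x e else 0) = 0) → x = 0) ↔ M.rank = Nat.card E := by
    have : (∀ x : E → K, (∀ w, ∑ e, ((if t e = w then x e else 0) -
        if s e = w then x e else 0) = 0) → x = 0) ↔ LinearIndependent K M.row := by
      rw [← Matrix.vecMul_injective_iff]
      change _ ↔ Function.Injective M.vecMulLinear
      rw [injective_iff_map_eq_zero]
      refine forall_congr' fun x => imp_congr_left ?_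
      rw [funext_iff]
      exact forall_congr' fun w => by rw [← hvec]; rfl
    rw [this, linearIndependent_iff_card_eq_finrank_span, Matrix.rank_eq_finrank_span_row,
      Nat.card_eq_fintype_card]
    exact eq_comm
  have h2 : Module.finrank K (LinearMap.ker M.mulVecLin) = Nat.card (Quot rel) := by
    let φ : (Quot rel → K) ≃ₗ[K] LinearMap.ker M.mulVecLin :=
      { toFun := fun z => ⟨fun w => z (Quot.mk _ w), by
          rw [LinearMap.mem_ker]
          ext e
          rw [Matrix.mulVecLin_apply, hmul, Pi.zero_apply, sub_eq_zero]
          exact congrArg z (Quot.sound ⟨e, rfl, rfl⟩).symm⟩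
        map_add' := fun _ _ => rfl
        map_smul' := fun _ _ => rfl
        invFun := fun y => Quot.lift y.1 (by
          rintro a b ⟨e, rfl, rfl⟩
          have := congrFun (LinearMap.mem_ker.1 y.2) e
          rw [Matrix.mulVecLin_apply, hmul, Pi.zero_apply, sub_eq_zero] at this
          exact this.symm)
        left_inv := fun z => by
          ext q
          induction q using Quot.ind
          rfl
        right_inv := fun y => rfl }
    have : Finite (Quot rel) := inferInstance
    have := Fintype.ofFinite (Quot rel)
    rw [← φ.finrank_eq, Module.finrank_pi, Nat.card_eq_fintype_card]
  have h3 := LinearMap.finrank_range_add_finrank_ker M.mulVecLin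
  rw [h2, Module.finrank_pi, ← Nat.card_eq_fintype_card] at h3
  change M.rank + _ = _ at h3
  rw [h1, ← h3]
  omega

/-- An integer that vanishes either in all fields or in none is `-1`, `0` or `1`. -/
theorem Int.mem_range_signType_of_forall_field {d : ℤ} {P : Prop}
    (h₀ : (d : ℚ) ≠ 0 → P) (h : ∀ p : ℕ, p.Prime → P → (d : ZMod p) ≠ 0) :
    d ∈ Set.range (SignType.cast : SignType → ℤ) := by
  by_cases hd : d = 0
  · exact ⟨0, by simp [hd]⟩
  have hP := h₀ (by exact_mod_cast hd)
  have h1 : d.natAbs = 1 := by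
    by_contra hne
    obtain ⟨p, hp, hpd⟩ := Nat.exists_prime_and_dvd hne
    exact h p hp hP ((ZMod.intCast_zmod_eq_zero_iff_dvd d p).2 (Int.natCast_dvd.2 hpd))
  rcases Int.natAbs_eq d with h | h
  · exact ⟨1, by rw [h, h1]; rfl⟩
  · exact ⟨-1, by rw [h, h1]; rfl⟩

namespace Matrix

/-- Replacing columns of `N` by columns of `N * A` multiplies the determinant by a minor of `A`. -/
theorem det_replace_columns {n U k R : Type*} [Fintype n] [DecidableEq n] [Fintype k]
    [DecidableEq k] [CommRing R] (N : Matrix n n R) (A : Matrix n U R) (f : k → n)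
    (hf : f.Injective) (g : k → U) (Y : Matrix n n R)
    (hY₁ : ∀ i v, Y v (f i) = (N * A) v (g i))
    (hY₂ : ∀ r, r ∉ Set.range f → ∀ v, Y v r = N v r) :
    Y.det = N.det * (A.submatrix f g).det := by
  classical
  -- `C` is the identity with column `f i` replaced by column `g i` of `A`. Then `Y = N * C`, and
  -- `C` is block triangular with diagonal blocks the minor of `A` and an identity.
  let C : Matrix n n R := Matrix.of fun s r =>
    if h : ∃ i, f i = r then A s (g h.choose) else (1 : Matrix n n R) s r
  have hC₁ : ∀ s i, C s (f i) = A s (g i) := by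
    intro s i
    have h : ∃ j, f j = f i := ⟨i, rfl⟩
    have : h.choose = i := hf h.choose_spec
    simp only [C, Matrix.of_apply, dif_pos h, this]
  have hC₂ : ∀ s r, r ∉ Set.range f → C s r = (1 : Matrix n n R) s r := by
    intro s r hr
    have h : ¬ ∃ j, f j = r := hr
    simp only [C, Matrix.of_apply, dif_neg h]
  have hYC : Y = N * C := by
    ext v r
    by_cases hr : r ∈ Set.range f
    · obtain ⟨i, rfl⟩ := hr
      rw [hY₁, Matrix.mul_apply, Matrix.mul_apply]
      simp only [hC₁]
    · rw [hY₂ r hr, Matrix.mul_apply]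
      simp only [hC₂ _ r hr]
      rw [← Matrix.mul_apply, Matrix.mul_one]
  rw [hYC, Matrix.det_mul]
  congr 1
  rw [Matrix.twoBlockTriangular_det' C (fun r => r ∈ Set.range f)]
  · have h2 : C.toSquareBlockProp (fun r => ¬ r ∈ Set.range f) = 1 := by
      ext s r
      rw [Matrix.toSquareBlockProp_def, Matrix.of_apply, hC₂ _ _ r.2, Matrix.one_apply,
        Matrix.one_apply]
      simp only [Subtype.ext_iff]
    have h3 : A.submatrix f g = (C.toSquareBlockProp fun r => r ∈ Set.range f).submatrix
        (Equiv.ofInjective f hf) (Equiv.ofInjective f hf) := by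
      ext i j
      simp [Matrix.toSquareBlockProp_def, hC₁]
    rw [h2, Matrix.det_one, mul_one, h3]
    convert (Matrix.det_submatrix_equiv_self _ _).symm
  · intro s hs r hr
    rw [hC₂ _ _ hr, Matrix.one_apply_ne]
    rintro rfl
    exact hr hs

/-- The columns of a matrix are linearly independent if and only if some maximal square submatrix
is nonsingular. -/
theorem linearIndependent_col_iff_exists_det_ne_zero {m k K : Type*} [Fintype m] [Fintype k]
    [DecidableEq k] [Field K] (B : Matrix m k K) :
    LinearIndependent K B.col ↔ ∃ f : k → m, (B.submatrix f id).det ≠ 0 := by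
  constructor
  · intro h
    have hr : B.rank = Fintype.card k := by
      rw [← Matrix.rank_transpose]
      exact LinearIndependent.rank_matrix (M := B.transpose) h
    obtain ⟨κ, a, -, hspan, hli⟩ := exists_linearIndependent' K B.row
    have : Finite κ := hli.finite
    have := Fintype.ofFinite κ
    have hcard : Fintype.card κ = Fintype.card k := by
      rw [← hr, Matrix.rank_eq_finrank_span_row, ← hspan, finrank_span_eq_card hli]
    let e : k ≃ κ := (Fintype.equivOfCardEq hcard).symm
    refine ⟨a ∘ e, ?_⟩
    have h1 : LinearIndependent K (B.submatrix (a ∘ e) id).row :=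
      hli.comp e e.injective
    rw [Matrix.linearIndependent_rows_iff_isUnit, Matrix.isUnit_iff_isUnit_det] at h1
    exact h1.ne_zero
  -- Selecting rows is a linear map on columns, and independence of the images implies independence
  -- of the columns themselves.
  · rintro ⟨f, hf⟩
    have h1 : LinearIndependent K (B.submatrix f id).col := by
      rw [Matrix.linearIndependent_cols_iff_isUnit, Matrix.isUnit_iff_isUnit_det]
      exact hf.isUnit
    exact LinearIndependent.of_comp (LinearMap.funLeft K K f) h1

/-- Linear independence of columns of a totally unimodular matrix, in terms of minors. -/
theorem IsTotallyUnimodular.linearIndepOn_col_iff_exists_det_ne_zero {m U K : Type*} [Fintype m]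
    [Field K] {A : Matrix m U ℤ} {S : Set U} [Fintype S] [DecidableEq S]
    (hA : (A.submatrix id ((↑) : S → U)).IsTotallyUnimodular) :
    LinearIndepOn K (A.map (Int.cast : ℤ → K)).col S ↔
      ∃ f : S → m, (A.submatrix f ((↑) : S → U)).det ≠ 0 := by
  have h1 : LinearIndepOn K (A.map (Int.cast : ℤ → K)).col S ↔ LinearIndependent K
    ((A.submatrix id ((↑) : S → U)).map (Int.cast : ℤ → K)).col := Iff.rfl
  rw [h1, linearIndependent_col_iff_exists_det_ne_zero]
  refine exists_congr fun f => not_congr ?_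
  have h2 : ((A.submatrix id ((↑) : S → U)).map (Int.cast : ℤ → K)).submatrix f id =
    (A.submatrix f ((↑) : S → U)).map (Int.castRingHom K) := rfl
  rw [h2, ← RingHom.mapMatrix_apply, ← RingHom.map_det]
  -- An integer minor equal to 0, 1 or -1 is nonzero in `K` exactly when it is nonzero in `ℤ`.
  obtain ⟨σ, hσ⟩ := (Matrix.isTotallyUnimodular_iff_fintype _).1 hA S f id
  have h3 : (A.submatrix id ((↑) : S → U)).submatrix f id = A.submatrix f ((↑) : S → U) := rfl
  rw [h3] at hσ
  rw [← hσ]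
  cases σ <;> simp

/-- Linear independence of columns of a totally unimodular matrix does not depend on the field. -/
theorem IsTotallyUnimodular.linearIndepOn_col_iff (K L : Type*) {m U : Type*} [Fintype m]
    [Finite U] [Field K] [Field L] {A : Matrix m U ℤ} {S : Set U}
    (hA : (A.submatrix id ((↑) : S → U)).IsTotallyUnimodular) :
    LinearIndepOn K (A.map (Int.cast : ℤ → K)).col S ↔
      LinearIndepOn L (A.map (Int.cast : ℤ → L)).col S := by
  classical
  have := Fintype.ofFinite S
  rw [hA.linearIndepOn_col_iff_exists_det_ne_zero, hA.linearIndepOn_col_iff_exists_det_ne_zero]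

/-- Multiplication by an invertible matrix preserves linear independence of columns. -/
theorem linearIndepOn_col_mul_iff {n U K : Type*} [Fintype n] [DecidableEq n] [Field K]
    {P : Matrix n n K} (hP : IsUnit P) (A : Matrix n U K) (S : Set U) :
    LinearIndepOn K (P * A).col S ↔ LinearIndepOn K A.col S := by
  have h : (P * A).col = P.mulVecLin ∘ A.col := by
    ext u v
    rfl
  rw [h]
  exact LinearMap.linearIndepOn_iff_of_injOn _ (Matrix.mulVec_injective_of_isUnit hP).injOn

end Matrix

/-- Matrices with the same independent sets of columns inside `S` have the same rank at `S`. -/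
theorem eRk_vectorMatroid_congr {X Y U K L : Type*} [Finite U] [Field K] [Field L]
    {A : Matrix X U K} {B : Matrix Y U L} {S : Set U}
    (h : ∀ I ⊆ S, LinearIndepOn K A.col I ↔ LinearIndepOn L B.col I) :
    (vectorMatroid A).eRk S = (vectorMatroid B).eRk S := by
  have : (vectorMatroid A).restrict S = (vectorMatroid B).restrict S := by
    refine Matroid.ext_indep rfl fun I hI => ?_
    rw [Matroid.restrict_indep_iff, Matroid.restrict_indep_iff]
    exact and_congr_left fun hIS => h I hIS
  rw [Matroid.eRk, this, Matroid.eRk]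

/-! ### Double occurrence words -/

/-- A double occurrence word in the letters `V`: `(v, false)` and `(v, true)` are the first and
second occurrences of `v`. -/
structure DoubleOccurrenceWord (V : Type*) [Fintype V] where
  pos : V × Bool ≃ Fin (Fintype.card (V × Bool))
  lt : ∀ v, pos (v, false) < pos (v, true)

/-- The side of the transition of kind `c` at a vertex containing the half-edge by which the vertex
is entered at its occurrence `b`. The transitions of kinds `0`, `1`, `2` are those that follow the
word, that are consistent with its orientation without following it, and that are inconsistent with
its orientation, respectively. -/
def inSide (c : Fin 3) (b : Bool) : Bool := ![!b, !b, true] c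

/-- The side of the transition of kind `c` at a vertex containing the half-edge by which the vertex
is left at its occurrence `b`. -/
def outSide (c : Fin 3) (b : Bool) : Bool := ![!b, b, false] c

/-- The vertex of a column index of `IAS(G)`. -/
def vertexOf {V : Type*} : V ⊕ V ⊕ V → V := Sum.elim id (Sum.elim id id)

/-- The kind of transition corresponding to a column index of `IAS(G)`. -/
def transitionKind {V : Type*} : V ⊕ V ⊕ V → Fin 3 :=
  Sum.elim (fun _ => 0) (Sum.elim (fun _ => 1) (fun _ => 2))

namespace DoubleOccurrenceWord

variable {V : Type*} [Fintype V] (D : DoubleOccurrenceWord V)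

/-- The cyclic successor. -/
def succ : Equiv.Perm (V × Bool) := D.pos.trans ((finRotate _).trans D.pos.symm)

theorem pos_succ (y : V × Bool) : (D.pos (D.succ y) : ℕ) = D.pos y + 1 ∨
    (D.pos y + 1 = Fintype.card (V × Bool) ∧ (D.pos (D.succ y) : ℕ) = 0) := by
  have h : D.pos (D.succ y) = finRotate _ (D.pos y) := by simp [succ]
  rw [h]
  generalize D.pos y = i
  revert i
  generalize Fintype.card (V × Bool) = N
  cases N with
  | zero => exact fun i => i.elim0
  | succ N =>
    intro i
    rw [coe_finRotate]
    split_ifs with hi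
    · exact Or.inr ⟨by rw [hi]; rfl, rfl⟩
    · exact Or.inl rfl

/-- The indicator function of the edges between the first and the second occurrence of `u`; the
edge entering the position of `y` is indexed by `y`. -/
def chord (u : V) (y : V × Bool) : ℤ :=
  if D.pos (u, false) < D.pos y ∧ D.pos y ≤ D.pos (u, true) then 1 else 0

/-- The edge leaving the position of `y` is the one entering the position of `D.succ y`, so a chord
starts just after its first occurrence and stops just after its second. The cyclic wrap causes no
exception because no chord uses the edge entering position 0. -/
theorem chord_succ [DecidableEq V] (u : V) (y : V × Bool) :
    D.chord u (D.succ y) = D.chord u y + if y.1 = u then (if y.2 then -1 else 1) else 0 := by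
  obtain ⟨v, b⟩ := y
  have h := D.pos_succ (v, b)
  have hlt := D.lt u
  have hN₁ := (D.pos (u, true)).isLt
  have hne : ∀ b', v ≠ u → (D.pos (v, b) : ℕ) ≠ D.pos (u, b') := by
    intro b' hvu he
    exact hvu (congrArg Prod.fst (D.pos.injective (Fin.ext he)))
  have h1 := hne false
  have h2 := hne true
  simp only [chord, Fin.lt_def, Fin.le_def] at *
  by_cases hvu : v = u
  · subst hvu
    cases b <;> simp only [if_true, Bool.false_eq_true, if_false] <;> split_ifs <;> omega
  · have h1 := h1 hvu
    have h2 := h2 hvu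
    simp only [hvu, if_false]
    split_ifs <;> omega

/-! ### Circulations as combinations of chords -/

section flow

variable {K : Type*} [CommRing K]

/-- The combination of chords with coefficients `l`. -/
def flow (l : V → K) (y : V × Bool) : K := ∑ u, l u * (D.chord u y : ℤ)

theorem flow_succ (l : V → K) (y : V × Bool) :
    D.flow l (D.succ y) = D.flow l y + if y.2 then -l y.1 else l y.1 := by
  classical
  simp only [flow, chord_succ, Int.cast_add, mul_add, Finset.sum_add_distrib]
  congr 1
  rw [Finset.sum_eq_single y.1]
  · cases y.2 <;> simp
  · intro b _ hb
    simp [hb.symm]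
  · simp

theorem flow_zero (y : V × Bool) : D.flow (0 : V → K) y = 0 := by simp [flow]

theorem flow_of_pos_eq_zero (l : V → K) {y : V × Bool} (hy : (D.pos y : ℕ) = 0) :
    D.flow l y = 0 := by
  refine Finset.sum_eq_zero fun u _ => ?_
  simp [chord, Fin.lt_def, hy]

/-- Starting from the value 0 at position 0, the prescribed jumps determine the function by
induction along the word. -/
theorem eq_flow {x : V × Bool → K} {l : V → K} (h₀ : ∀ y, (D.pos y : ℕ) = 0 → x y = 0)
    (h : ∀ y, x (D.succ y) = x y + if y.2 then -l y.1 else l y.1) : x = D.flow l := by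
  have key : ∀ n : ℕ, ∀ y, (D.pos y : ℕ) = n → x y = D.flow l y := by
    intro n
    induction n with
    | zero =>
      intro y hy
      rw [h₀ y hy, D.flow_of_pos_eq_zero l hy]
    | succ n ih =>
      intro y hy
      have hz : (D.pos (D.succ.symm y) : ℕ) = n := by
        have := D.pos_succ (D.succ.symm y)
        rw [Equiv.apply_symm_apply] at this
        omega
      have h1 := h (D.succ.symm y)
      have h2 := D.flow_succ l (D.succ.symm y)
      rw [Equiv.apply_symm_apply] at h1 h2
      rw [h1, h2, ih _ hz]
  exact funext fun y => key _ y rfl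

/-- The net inflow into the side `s` of the transition of kind `c` at the vertex `w`. -/
def net (c : Fin 3) (s : Bool) (w : V) (x : V × Bool → K) : K :=
  ∑ b, ((if inSide c b = s then x (w, b) else 0) - if outSide c b = s then x (D.succ (w, b)) else 0)

/-- The two halves of a split vertex together receive the net inflow of the whole vertex. For a
circulation this is zero, so balance on the side `true` already forces balance on the side `false`.
-/
theorem net_true_add_net_false (c : Fin 3) (w : V) (x : V × Bool → K) :
    D.net c true w x + D.net c false w x = ∑ b, (x (w, b) - x (D.succ (w, b))) := by
  fin_cases c <;> simp [net, inSide, outSide] <;> ring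

theorem sum_flow_sub_flow_succ (l : V → K) (w : V) :
    ∑ b, (D.flow l (w, b) - D.flow l (D.succ (w, b))) = 0 := by
  simp [flow_succ]

theorem net_flow (c : Fin 3) (s : Bool) (w : V) (l : V → K) :
    D.net c s w (D.flow l) =
      ∑ u, l u * ((D.net c s w (D.chord u) : ℤ) : K) := by
  simp only [net, flow, Fintype.sum_bool, Int.cast_add, Int.cast_sub, mul_add, mul_sub,
    Finset.sum_add_distrib, Finset.sum_sub_distrib]
  congr 2 <;> split_ifs <;> simp

end flow

open Classical in
/-- The vertex, in the graph in which the vertices of `Z` are split according to the transitions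
`τ`, at which the half-edge entering the position of `y` ends. -/
noncomputable def splitIn (τ : V → Fin 3) (Z : Set V) (y : V × Bool) : V × Bool :=
  (y.1, if y.1 ∈ Z then inSide (τ y.1) y.2 else true)

open Classical in
/-- The vertex, in the graph in which the vertices of `Z` are split according to the transitions
`τ`, at which the half-edge leaving the position of `y` starts. -/
noncomputable def splitOut (τ : V → Fin 3) (Z : Set V) (y : V × Bool) : V × Bool :=
  (y.1, if y.1 ∈ Z then outSide (τ y.1) y.2 else true)

/-- A vertex `v` outside `Z` stays whole as `(v, true)`, and `(v, false)` is then isolated: it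
imposes no balance condition and raises the numbers of vertices and of components by one each, which
does not affect the forest criterion. -/
theorem sum_split [DecidableEq V] {K : Type*} [CommRing K] (τ : V → Fin 3) (Z : Set V)
    (x : V × Bool → K) (v : V) (s : Bool) :
    ∑ y, ((if splitIn τ Z y = (v, s) then x y else 0) -
      if splitOut τ Z y = (v, s) then x (D.succ y) else 0) =
    open Classical in if v ∈ Z then D.net (τ v) s v x else
      if s = true then ∑ b, (x (v, b) - x (D.succ (v, b))) else 0 := by
  rw [Fintype.sum_prod_type, Finset.sum_eq_single v]
  · by_cases hv : v ∈ Z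
    · simp [splitIn, splitOut, hv, net]
    · cases s <;> simp [splitIn, splitOut, hv]
  · intro w _ hw
    simp [splitIn, splitOut, hw]
  · simp

/-- Whether a combination of chords is determined by its values on a set `X` of edges and by the
net inflows at the transitions `τ` at the vertices in `Z` does not depend on the field. -/
theorem forall_eq_zero_iff (K : Type*) [Field K] (τ : V → Fin 3) (Z : Set V) (X : Set (V × Bool))
    (hX : ∀ y, (D.pos y : ℕ) = 0 → y ∈ X) :
    (∀ l : V → K, (∀ y ∈ X, D.flow l y = 0) → (∀ w ∈ Z, D.net (τ w) true w (D.flow l) = 0) →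
      l = 0) ↔
    Nat.card {y // y ∉ X} + Nat.card (Quot fun a b => ∃ e : {y // y ∉ X},
      splitOut τ Z (D.succ.symm e) = a ∧ splitIn τ Z e = b) = Nat.card (V × Bool) := by
  classical
  rw [← forall_flow_eq_zero_iff (K := K) (fun e : {y // y ∉ X} => splitOut τ Z (D.succ.symm e))
    (fun e => splitIn τ Z e)]
  -- For functions vanishing on `X`, deleting the edges in `X` changes no balance; the outgoing
  -- terms are reindexed by `D.succ`.
  have hsum : ∀ (x : V × Bool → K), (∀ y ∈ X, x y = 0) → ∀ w,
      ∑ e : {y // y ∉ X}, ((if splitIn τ Z e = w then x e else 0) -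
        if splitOut τ Z (D.succ.symm e) = w then x e else 0) =
      ∑ y, ((if splitIn τ Z y = w then x y else 0) -
        if splitOut τ Z y = w then x (D.succ y) else 0) := by
    intro x hx w
    let f : V × Bool → K := fun y => (if splitIn τ Z y = w then x y else 0) -
      if splitOut τ Z (D.succ.symm y) = w then x y else 0
    have h1 : ∑ e : {y // y ∉ X}, f e = ∑ y, f y := by
      rw [← Finset.sum_subtype (Finset.univ.filter (· ∉ X)) (by simp) f]
      refine Finset.sum_filter_of_ne fun y _ hy hyX => hy ?_
      simp [f, hx y hyX]
    refine h1.trans ?_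
    simp only [f, Finset.sum_sub_distrib]
    rw [← Equiv.sum_comp D.succ (fun y => if splitOut τ Z (D.succ.symm y) = w then x y else 0)]
    simp only [Equiv.symm_apply_apply]
  constructor
  · intro h x hx
    let x' : V × Bool → K := fun y => if hy : y ∉ X then x ⟨y, hy⟩ else 0
    have hx' : ∀ e : {y // y ∉ X}, x' e = x e := fun e => by simp [x', e.2]
    have hX' : ∀ y ∈ X, x' y = 0 := fun y hy => by simp [x', hy]
    have hdiv : ∀ v s, (if v ∈ Z then D.net (τ v) s v x' else
        if s = true then ∑ b, (x' (v, b) - x' (D.succ (v, b))) else 0) = 0 := by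
      intro v s
      rw [← D.sum_split τ Z x' v s, ← hsum x' hX']
      simp only [hx']
      exact hx _
    have hcons : ∀ v, ∑ b, (x' (v, b) - x' (D.succ (v, b))) = 0 := by
      intro v
      have h1 := hdiv v true
      have h2 := hdiv v false
      by_cases hv : v ∈ Z
      · rw [if_pos hv] at h1 h2
        rw [← D.net_true_add_net_false (τ v), h1, h2, add_zero]
      · simpa [hv] using h1
    -- The coefficient of `v` has to be the jump at its first occurrence; conservation at `v` makes
    -- the jump at the second occurrence its negative.
    have hflow : x' = D.flow (fun v => x' (D.succ (v, false)) - x' (v, false)) := by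
      refine D.eq_flow (fun y hy => hX' y (hX y hy)) ?_
      rintro ⟨v, b⟩
      have := hcons v
      rw [Fintype.sum_bool] at this
      cases b
      · simp
      · simp only [if_true]
        linear_combination -this
    have hl := h (fun v => x' (D.succ (v, false)) - x' (v, false)) (by rwa [← hflow])
      (by
        intro w hw
        rw [← hflow]
        simpa [hw] using hdiv w true)
    rw [hl] at hflow
    ext e
    rw [← hx', hflow, flow_zero, Pi.zero_apply]
  · intro h l hl hZ
    have h0 : ∀ y, D.flow l y = 0 := by
      intro y
      by_cases hy : y ∈ X
      · exact hl y hy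
      · have := h (fun e => D.flow l e) (by
          rintro ⟨v, s⟩
          rw [hsum _ hl, D.sum_split]
          by_cases hv : v ∈ Z
          · rw [if_pos hv]
            cases s
            · have := D.net_true_add_net_false (τ v) v (D.flow l)
              rwa [sum_flow_sub_flow_succ, hZ v hv, zero_add] at this
            · exact hZ v hv
          · rw [if_neg hv, sum_flow_sub_flow_succ, ite_self])
        exact congrFun this ⟨y, hy⟩
    -- The coefficient of `v` is recovered as the jump of the flow at the first occurrence of `v`.
    ext v
    have := D.flow_succ l (v, false)
    rw [h0, h0] at this
    simpa using this.symm

end DoubleOccurrenceWord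

/-! ### The representation given by a double occurrence word -/

theorem IsSubtransversal.injOn_vertexOf {V : Type*} {S : Set (V ⊕ V ⊕ V)}
    (hS : IsSubtransversal (vertexTriples V) S) : Set.InjOn vertexOf S := by
  obtain ⟨T, hT, hST⟩ := hS
  have hmem : ∀ x : V ⊕ V ⊕ V, x ∈ vertexTriple (vertexOf x) := by
    rintro (v | v | v) <;> simp [vertexTriple, vertexOf]
  intro x hx y hy hxy
  exact (hT _ ⟨vertexOf x, rfl⟩).unique ⟨hST hx, hmem x⟩ ⟨hST hy, hxy ▸ hmem y⟩

theorem isSubtransversal_range_inl (V : Type*) :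
    IsSubtransversal (vertexTriples V) (Set.range (Sum.inl : V → V ⊕ V ⊕ V)) := by
  refine ⟨_, ?_, subset_rfl⟩
  rintro _ ⟨v, rfl⟩
  refine ⟨.inl v, ⟨⟨v, rfl⟩, by simp [vertexTriple]⟩, ?_⟩
  rintro _ ⟨⟨w, rfl⟩, hw⟩
  simpa [vertexTriple] using hw

namespace DoubleOccurrenceWord

variable {V : Type*} [Fintype V] (D : DoubleOccurrenceWord V)

/-- Two letters alternate in the word. -/
def Alternates (u v : V) : Prop :=
  (D.pos (u, false) < D.pos (v, false) ∧ D.pos (v, false) < D.pos (u, true) ∧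
    D.pos (u, true) < D.pos (v, true)) ∨
  (D.pos (v, false) < D.pos (u, false) ∧ D.pos (u, false) < D.pos (v, true) ∧
    D.pos (v, true) < D.pos (u, true))

/-- The values of the chords at the edges entering second occurrences. -/
def chordMatrix : Matrix V V ℤ := Matrix.of fun u r => D.chord u (r, true)

/-- The net inflows of the chords at the transitions. -/
def netMatrix : Matrix V (V ⊕ V ⊕ V) ℤ :=
  Matrix.of fun u e => D.net (transitionKind e) true (vertexOf e) (D.chord u)

section

variable [DecidableEq V]

/-- A row vector `l` is in the left kernel of `Y` exactly when the circulation `D.flow l` vanishes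
on the retained second-occurrence edges and is balanced at the chosen transitions. By
`forall_eq_zero_iff`, whether this forces `l = 0` is a combinatorial condition, the same over `ℚ`
and over every `ZMod p`. -/
theorem det_mem_range_signType {k : Type*} (τ : V → Fin 3) (f w : k → V)
    (Y : Matrix V V ℤ) (hY₁ : ∀ i v, Y v (f i) = D.net (τ (w i)) true (w i) (D.chord v))
    (hY₂ : ∀ r, r ∉ Set.range f → ∀ v, Y v r = D.chord v (r, true)) :
    Y.det ∈ Set.range (SignType.cast : SignType → ℤ) := by
  -- The edge entering position 0 may be deleted at no cost, since all chords vanish on it; its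
  -- deletion is what identifies circulations with combinations of chords.
  set X : Set (V × Bool) := {y | (D.pos y : ℕ) = 0 ∨ ∃ r, r ∉ Set.range f ∧ y = (r, true)} with hX
  have key : ∀ (K : Type) [Field K], (Y.det : K) ≠ 0 ↔
      Nat.card {y // y ∉ X} + Nat.card (Quot fun a b => ∃ e : {y // y ∉ X},
        splitOut τ (Set.range w) (D.succ.symm e) = a ∧ splitIn τ (Set.range w) e = b) =
          Nat.card (V × Bool) := by
    intro K _
    rw [← D.forall_eq_zero_iff K τ (Set.range w) X (fun y hy => Or.inl hy)]
    have h1 : (Y.det : K) = (Y.map (Int.castRingHom K)).det := by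
      rw [← RingHom.mapMatrix_apply, ← RingHom.map_det]
      rfl
    rw [h1, ne_eq, ← Matrix.exists_vecMul_eq_zero_iff]
    push Not
    refine forall_congr' fun l => ?_
    have h2 : Matrix.vecMul l (Y.map (Int.castRingHom K)) = 0 ↔
        (∀ y ∈ X, D.flow l y = 0) ∧
          ∀ v ∈ Set.range w, D.net (τ v) true v (D.flow l) = 0 := by
      have hf : ∀ i, Matrix.vecMul l (Y.map (Int.castRingHom K)) (f i) =
          D.net (τ (w i)) true (w i) (D.flow l) := by
        intro i
        simp [Matrix.vecMul, dotProduct, hY₁, net_flow]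
      have hr : ∀ r, r ∉ Set.range f → Matrix.vecMul l (Y.map (Int.castRingHom K)) r =
          D.flow l (r, true) := by
        intro r hr
        simp [Matrix.vecMul, dotProduct, hY₂ r hr, flow]
      constructor
      · intro h
        constructor
        · rintro y (hy | ⟨r, hrf, rfl⟩)
          · exact D.flow_of_pos_eq_zero l hy
          · rw [← hr r hrf, h, Pi.zero_apply]
        · rintro _ ⟨i, rfl⟩
          rw [← hf, h, Pi.zero_apply]
      · rintro ⟨h, h'⟩
        ext r
        by_cases hrf : r ∈ Set.range f
        · obtain ⟨i, rfl⟩ := hrf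
          rw [hf, h' _ ⟨i, rfl⟩, Pi.zero_apply]
        · rw [hr r hrf, h _ (Or.inr ⟨r, hrf, rfl⟩), Pi.zero_apply]
    constructor
    · intro h ha hb
      by_contra hl
      exact h hl (h2.2 ⟨ha, hb⟩)
    · intro h hl h0
      exact hl (h (h2.1 h0).1 (h2.1 h0).2)
  refine Int.mem_range_signType_of_forall_field (key ℚ).1 fun p hp => ?_
  have := Fact.mk hp
  exact (key (ZMod p)).2

/-- A chord has value 1 at its own second occurrence and 0 at all later ones. Hence in a vanishing
combination the chord with nonzero coefficient that ends last gives a contradiction. A nonzero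
determinant is a unit by `det_mem_range_signType` with no column replaced. -/
theorem isUnit_det_chordMatrix : IsUnit D.chordMatrix.det := by
  have hne : D.chordMatrix.det ≠ 0 := by
    rw [ne_eq, ← Matrix.exists_vecMul_eq_zero_iff]
    rintro ⟨l, hl, h0⟩
    obtain ⟨u₀, hu₀⟩ := Function.ne_iff.1 hl
    obtain ⟨u, hu, hmax⟩ := Finset.exists_max_image (Finset.univ.filter fun u => l u ≠ 0)
      (fun u => D.pos (u, true)) ⟨u₀, by simpa using hu₀⟩
    have h1 := congrFun h0 u
    rw [Matrix.vecMul, dotProduct, Finset.sum_eq_single u] at h1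
    · simp [chordMatrix, chord, D.lt u] at h1
      simp [h1] at hu
    · intro v _ hvu
      by_cases hv : l v = 0
      · simp [hv]
      · have h2 := hmax v (by simpa using hv)
        have h3 : D.pos (v, true) ≠ D.pos (u, true) := by
          simpa using hvu
        have h4 : ¬ D.pos (u, true) ≤ D.pos (v, true) := fun h => h3 (le_antisymm h2 h)
        simp [chordMatrix, chord, h4]
    · simp
  obtain ⟨σ, hσ⟩ := D.det_mem_range_signType (k := Empty) (fun _ => 0) Empty.elim Empty.elim
    D.chordMatrix (fun i => i.elim) (fun _ _ _ => rfl)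
  rw [← hσ] at hne ⊢
  cases σ <;> simp at hne ⊢

/-- The integer matrix representing the 3-matroid of the interlacement graph. -/
noncomputable def repMatrix : Matrix V (V ⊕ V ⊕ V) ℤ := D.chordMatrix⁻¹ * D.netMatrix

theorem chordMatrix_mul_repMatrix : D.chordMatrix * D.repMatrix = D.netMatrix :=
  Matrix.mul_nonsing_inv_cancel_left _ _ D.isUnit_det_chordMatrix

/-- Multiplying by `D.chordMatrix`, of determinant 1 or -1, turns a minor into a determinant of the
kind treated in `det_mem_range_signType`. -/
theorem isTotallyUnimodular_repMatrix {S : Set (V ⊕ V ⊕ V)}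
    (hS : IsSubtransversal (vertexTriples V) S) :
    (D.repMatrix.submatrix id ((↑) : S → V ⊕ V ⊕ V)).IsTotallyUnimodular := by
  classical
  intro k f g hf hg
  -- A subtransversal selects at most one transition at each vertex. The value 0 at the other
  -- vertices is immaterial, because they are not split.
  obtain ⟨τ, hτ⟩ : ∃ τ : V → Fin 3, ∀ e ∈ S, τ (vertexOf e) = transitionKind e := by
    refine ⟨fun v => if h : ∃ e ∈ S, vertexOf e = v then transitionKind h.choose else 0, ?_⟩
    intro e he
    have h : ∃ e' ∈ S, vertexOf e' = vertexOf e := ⟨e, he, rfl⟩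
    have h1 : h.choose = e := hS.injOn_vertexOf h.choose_spec.1 he h.choose_spec.2
    simp only [dif_pos h, h1]
  let Y : Matrix V V ℤ := Matrix.of fun v r =>
    if h : ∃ i, f i = r then D.netMatrix v (g h.choose) else D.chordMatrix v r
  have hY₁ : ∀ i v, Y v (f i) = D.netMatrix v (g i) := by
    intro i v
    have h : ∃ j, f j = f i := ⟨i, rfl⟩
    have : h.choose = i := hf h.choose_spec
    simp only [Y, Matrix.of_apply, dif_pos h, this]
  have hY₂ : ∀ r, r ∉ Set.range f → ∀ v, Y v r = D.chordMatrix v r := by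
    intro r hr v
    have h : ¬ ∃ j, f j = r := hr
    simp only [Y, Matrix.of_apply, dif_neg h]
  have hdet := Matrix.det_replace_columns D.chordMatrix D.repMatrix f hf (fun i => (g i : V ⊕ V ⊕ V))
    Y (by rwa [chordMatrix_mul_repMatrix]) hY₂
  have hYdet := D.det_mem_range_signType τ f (fun i => vertexOf (g i : V ⊕ V ⊕ V)) Y
    (fun i v => by rw [hY₁, hτ _ (g i).2]; rfl) hY₂
  rw [hdet] at hYdet
  rw [Matrix.submatrix_submatrix]
  obtain ⟨σ, hσ⟩ := hYdet
  rcases Int.isUnit_iff.1 D.isUnit_det_chordMatrix with h | h <;> rw [h] at hσ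
  · exact ⟨σ, by rw [hσ, one_mul]; rfl⟩
  · exact ⟨-σ, by rw [SignType.coe_neg, hσ, neg_one_mul, neg_neg]; rfl⟩

/-- By `chord_succ`, the inflow of the chord of `u` at the transitions of kinds 0, 1 and 2 of `v`
can be written in terms of its values on the two edges entering `v`. Modulo 2, kind 0 leaves only
the jump at `v`, kind 2 the sum of both values, and kind 1 the sum of these two. -/
theorem map_netMatrix (G : SimpleGraph V) [DecidableRel G.Adj]
    (hG : ∀ u v, G.Adj u v ↔ D.Alternates u v) :
    D.netMatrix.map (Int.cast : ℤ → ZMod 2) = IAS G := by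
  have hne : ∀ u v : V, u ≠ v → ∀ b b', (D.pos (u, b) : ℕ) ≠ D.pos (v, b') := fun u v huv b b' he =>
    huv (congrArg Prod.fst (D.pos.injective (Fin.ext he)))
  -- For `u ≠ v` the sum counts the occurrences of `v` between those of `u`, which is odd exactly
  -- when the letters alternate. For `u = v` only the edge entering the second occurrence
  -- contributes.
  have h01 : ∀ u v : V, ((D.chord u (v, false) + D.chord u (v, true) : ℤ) : ZMod 2) =
      G.adjMatrix (ZMod 2) u v + if u = v then 1 else 0 := by
    intro u v
    rw [SimpleGraph.adjMatrix_apply]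
    by_cases huv : u = v
    · subst huv
      simp [chord, D.lt u]
    · have hu := D.lt u
      have hv := D.lt v
      have h1 := hne u v huv false false
      have h2 := hne u v huv false true
      have h3 := hne u v huv true false
      have h4 := hne u v huv true true
      simp only [hG, chord, Alternates, Fin.lt_def, Fin.le_def, huv, if_false, add_zero] at *
      split_ifs <;> first | omega | (simp; done) | (exact (by decide : ((1 + 1 : ℤ) : ZMod 2) = 0))
  have two : (1 : ZMod 2) + 1 = 0 := rfl
  have hneg : ∀ a : ZMod 2, -a = a := ZMod.neg_eq_self_mod_two
  ext u (v | v | v)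
  · have : D.net 0 true v (D.chord u) = D.chord u (v, false) - D.chord u (D.succ (v, false)) := by
      simp [net, inSide, outSide]
    simp only [netMatrix, Matrix.map_apply, Matrix.of_apply, transitionKind, vertexOf, Sum.elim_inl,
      id, this, chord_succ, IAS, Matrix.fromCols_apply_inl, Matrix.one_apply, eq_comm (a := v)]
    split_ifs <;> simp [hneg]
  · have : D.net 1 true v (D.chord u) = D.chord u (v, false) - D.chord u (D.succ (v, true)) := by
      simp [net, inSide, outSide]
    have h := h01 u v
    rw [Int.cast_add] at h
    simp only [netMatrix, Matrix.map_apply, Matrix.of_apply, transitionKind, vertexOf, Sum.elim_inl,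
      Sum.elim_inr, id, this, chord_succ, IAS, Matrix.fromCols_apply_inl, Matrix.fromCols_apply_inr,
      eq_comm (a := v), Int.cast_sub, Int.cast_add]
    rw [sub_eq_add_neg, hneg, ← add_assoc, h]
    split_ifs <;> simp [add_assoc, hneg, two]
  · have : D.net 2 true v (D.chord u) = D.chord u (v, false) + D.chord u (v, true) := by
      simp [net, inSide, outSide, add_comm]
    simp only [netMatrix, Matrix.map_apply, Matrix.of_apply, transitionKind, vertexOf,
      Sum.elim_inr, id, this, IAS, Matrix.fromCols_apply_inr, Matrix.add_apply, Matrix.one_apply]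
    rw [h01, add_comm]

/-- The representation theorem for the interlacement graph of a double occurrence word. -/
theorem exists_strict_representation (G : SimpleGraph V) [DecidableRel G.Adj]
    (hG : ∀ u v, G.Adj u v ↔ D.Alternates u v) :
    ∃ (m : ℕ) (A : Matrix (Fin m) (V ⊕ V ⊕ V) ℚ),
      (Z₃ G).IsStrictRepresentation A ∧ (Z₃ G).IsTotallyTransversallyUnimodular A := by
  classical
  let e : Fin (Fintype.card V) ≃ V := (Fintype.equivFin V).symm
  let B : Matrix (Fin (Fintype.card V)) (V ⊕ V ⊕ V) ℤ := D.repMatrix.submatrix e id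
  let A : Matrix (Fin (Fintype.card V)) (V ⊕ V ⊕ V) ℚ := B.map Int.cast
  have hTU : ∀ S, IsSubtransversal (vertexTriples V) S →
      (B.submatrix id ((↑) : S → V ⊕ V ⊕ V)).IsTotallyUnimodular := fun S hS =>
    (D.isTotallyUnimodular_repMatrix hS).submatrix e id
  have hindep : ∀ S, IsSubtransversal (vertexTriples V) S →
      (LinearIndepOn ℚ A.col S ↔ LinearIndepOn (ZMod 2) (IAS G).col S) := by
    intro S hS
    -- Unimodularity passes from `ℚ` to `GF(2)`, where the matrix differs from `IAS G` only by an
    -- invertible left factor and a relabelling of rows.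
    rw [(hTU S hS).linearIndepOn_col_iff ℚ (ZMod 2), ← D.map_netMatrix G hG,
      ← D.chordMatrix_mul_repMatrix]
    have h1 : (D.chordMatrix * D.repMatrix).map (Int.cast : ℤ → ZMod 2) =
        D.chordMatrix.map (Int.castRingHom (ZMod 2)) * D.repMatrix.map (Int.castRingHom (ZMod 2)) :=
      Matrix.map_mul (f := Int.castRingHom (ZMod 2))
    rw [h1, Matrix.linearIndepOn_col_mul_iff]
    · have h2 : (B.map (Int.cast : ℤ → ZMod 2)).col =
          LinearMap.funLeft (ZMod 2) (ZMod 2) e ∘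
            (D.repMatrix.map (Int.castRingHom (ZMod 2))).col := rfl
      rw [h2]
      exact LinearMap.linearIndepOn_iff_of_injOn _
        (LinearMap.funLeft_injective_of_surjective _ _ _ e.surjective).injOn
    · rw [Matrix.isUnit_iff_isUnit_det, ← RingHom.mapMatrix_apply, ← RingHom.map_det]
      exact D.isUnit_det_chordMatrix.map _
  have hshelter : (Z₃ G).IsShelteredBy (vectorMatroid A) := by
    refine ⟨rfl, ?_⟩
    rintro ⟨S, hS⟩
    rw [eRk_vectorMatroid_congr fun I hI => hindep I (hS.subset hI), eRk_vectorMatroid_IAS]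
    rfl
  refine ⟨_, A, ⟨hshelter, ?_, ?_⟩, ?_⟩
  -- The transversal of the columns of `I` is independent and has as many elements as `A` has rows,
  -- so it attains the rank of `A`.
  · refine ⟨⟨_, isSubtransversal_range_inl V⟩, ?_⟩
    change ((Z₃ G).r _ : ℕ∞) = _
    rw [← hshelter.2]
    refine le_antisymm (Matroid.eRk_le_eRank _ _) ?_
    have h1 : (vectorMatroid A).Indep (Set.range Sum.inl) := by
      change LinearIndepOn ℚ A.col _
      rw [hindep _ (isSubtransversal_range_inl V), linearIndepOn_range_iff Sum.inl_injective]
      have : (IAS G).col ∘ Sum.inl = (1 : Matrix V V (ZMod 2)).col := by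
        ext u v
        rfl
      rw [this, Matrix.linearIndependent_cols_iff_isUnit]
      exact isUnit_one
    rw [h1.eRk_eq_encard]
    obtain ⟨b, hb⟩ := (vectorMatroid A).exists_isBase
    have hbi : LinearIndepOn ℚ A.col b := hb.indep
    rw [← hb.encard_eq_eRank, Set.encard_eq_coe_toFinset_card, Set.toFinset_card,
      ← Set.image_univ, Sum.inl_injective.encard_image, Set.encard_univ,
      ENat.card_eq_coe_fintype_card]
    have := hbi.fintype_card_le_finrank
    rw [Module.finrank_pi, Fintype.card_fin] at this
    exact_mod_cast this
  · rintro _ ⟨S, rfl⟩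
    change ((Z₃ G).r S : ℕ∞) ≤ _
    rw [← hshelter.2]
    exact Matroid.eRk_le_eRank _ _
  · intro S hS k f g hf hg
    obtain ⟨σ, hσ⟩ := hTU S hS k f g hf hg
    refine ⟨σ, ?_⟩
    have h1 : (A.submatrix id ((↑) : S → V ⊕ V ⊕ V)).submatrix f g =
      ((B.submatrix id ((↑) : S → V ⊕ V ⊕ V)).submatrix f g).map (Int.castRingHom ℚ) := rfl
    rw [h1, ← RingHom.mapMatrix_apply, ← RingHom.map_det, ← hσ]
    cases σ <;> simp

end

end DoubleOccurrenceWord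

/-! ### Double occurrence words of Euler systems -/

theorem exists_equiv_fin_lt_iff {P α : Type*} [Fintype P] [LinearOrder α] {f : P → α}
    (hf : f.Injective) : ∃ e : P ≃ Fin (Fintype.card P), ∀ x y, e x < e y ↔ f x < f y := by
  let _ : LinearOrder P := LinearOrder.lift' f hf
  exact ⟨(Fintype.orderIsoFinOfCardEq P rfl).symm.toEquiv,
    fun x y => (Fintype.orderIsoFinOfCardEq P rfl).symm.lt_iff_lt⟩

theorem List.exists_lt_get_of_count_eq_two {α : Type*} [DecidableEq α] {l : List α} {a : α}
    (h : l.count a = 2) : ∃ i j : Fin l.length, i < j ∧ ∀ k, l.get k = a ↔ k = i ∨ k = j := by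
  have h1 := Fin.card_filter_univ_eq_vector_get_eq_count a ⟨l, rfl⟩
  rw [show List.Vector.toList (⟨l, rfl⟩ : List.Vector α l.length) = l from rfl, h, Finset.card_eq_two] at h1
  obtain ⟨x, y, hxy, hs⟩ := h1
  have hmem : ∀ k, l.get k = a ↔ k = x ∨ k = y := by
    intro k
    have := Finset.ext_iff.1 hs k
    rw [Finset.mem_filter_univ] at this
    rw [Finset.mem_insert, Finset.mem_singleton] at this
    exact this
  rcases lt_or_gt_of_ne hxy with hlt | hlt
  · exact ⟨x, y, hlt, hmem⟩
  · exact ⟨y, x, hlt, fun k => (hmem k).trans or_comm⟩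

/-- Each letter occurs at exactly two indices, so an embedding of the alternating pattern must use
all four of them in order. -/
theorem List.sublist_alternating_iff {α : Type*} {l : List α} {a b : α}
    {i j i' j' : Fin l.length} (hij : i < j) (hij' : i' < j')
    (h : ∀ k, l.get k = a ↔ k = i ∨ k = j) (h' : ∀ k, l.get k = b ↔ k = i' ∨ k = j') :
    [a, b, a, b].Sublist l ↔ i < i' ∧ i' < j ∧ j < j' := by
  rw [List.sublist_iff_exists_fin_orderEmbedding_get_eq]
  constructor
  · rintro ⟨f, hf⟩
    have l₀ : f ⟨0, by simp⟩ < f ⟨1, by simp⟩ := f.lt_iff_lt.2 (by simp)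
    have l₁ : f ⟨1, by simp⟩ < f ⟨2, by simp⟩ := f.lt_iff_lt.2 (by simp)
    have l₂ : f ⟨2, by simp⟩ < f ⟨3, by simp⟩ := f.lt_iff_lt.2 (by simp)
    have e₀ := (h _).1 (hf ⟨0, by simp⟩).symm
    have e₁ := (h' _).1 (hf ⟨1, by simp⟩).symm
    have e₂ := (h _).1 (hf ⟨2, by simp⟩).symm
    have e₃ := (h' _).1 (hf ⟨3, by simp⟩).symm
    simp only [Fin.lt_def, Fin.ext_iff] at *
    omega
  · rintro ⟨h₁, h₂, h₃⟩
    refine ⟨OrderEmbedding.ofStrictMono (![i, i', j, j'] : Fin 4 → Fin l.length) ?_, ?_⟩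
    · rw [Fin.strictMono_iff_lt_succ]
      intro k
      fin_cases k
      · exact h₁
      · exact h₂
      · exact h₃
    · intro k
      change Fin 4 at k
      fin_cases k
      · exact ((h i).2 (Or.inl rfl)).symm
      · exact ((h' i').2 (Or.inl rfl)).symm
      · exact ((h j).2 (Or.inr rfl)).symm
      · exact ((h' j').2 (Or.inr rfl)).symm

/-! ### From Euler systems to double occurrence words -/

namespace HalfEdgeGraph

variable {V H : Type*} {F : HalfEdgeGraph V H}

/-- Each transition contributes both of its half-edges to the vertex it visits. With four distinct
half-edges at a vertex, this gives two visits. -/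
theorem countP_halfEdges [DecidableEq V] (v : V) (W : List (H × H))
    (hW : ∀ p ∈ W, F.ε p.1 = F.ε p.2) :
    (halfEdges W).countP (fun h => F.ε h = v) = 2 * (F.visits W).count v := by
  induction W with
  | nil => simp [halfEdges, visits]
  | cons p W ih =>
    have h1 := ih fun q hq => hW q (List.mem_cons_of_mem _ hq)
    have h2 := hW p List.mem_cons_self
    have h3 : halfEdges (p :: W) = p.1 :: p.2 :: halfEdges W := rfl
    have h4 : F.visits (p :: W) = F.ε p.1 :: F.visits W := rfl
    rw [h3, h4, List.countP_cons, List.countP_cons, List.count_cons, h1, ← h2]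
    by_cases h : F.ε p.1 = v <;> simp [h]
    ring

/-- An Euler system of a 4-regular graph visits every vertex twice. -/
theorem EulerSystem.count_visits [DecidableEq V] (C : F.EulerSystem) (hF : F.IsFourRegular)
    (v : V) : (F.visits (C.circuit (F.component v))).count v = 2 := by
  classical
  have hC := C.isOrientedCircuit (F.component v)
  have h1 := F.countP_halfEdges v _ hC.transition
  rw [List.countP_eq_length_filter, ← List.toFinset_card_of_nodup (hC.nodup.filter _),
    ← Set.ncard_coe_finset] at h1
  have h2 : (((halfEdges (C.circuit (F.component v))).filter
      (fun h => decide (F.ε h = v))).toFinset : Set H) = {h | F.ε h = v} := by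
    ext h
    simp only [List.coe_toFinset, List.mem_filter, C.eulerian, decide_eq_true_eq,
      Set.mem_ofPred_eq, and_iff_right_iff_imp]
    rintro rfl
    rfl
  rw [h2, hF v] at h1
  omega

/-- Interlacement with respect to an Euler system is alternation in a double occurrence word. -/
theorem EulerSystem.exists_alternates_iff [Fintype V] (C : F.EulerSystem) (hF : F.IsFourRegular) :
    ∃ D : DoubleOccurrenceWord V, ∀ u v, C.Interlaced u v ↔ D.Alternates u v := by
  classical
  have : Finite F.Component := inferInstanceAs (Finite (Quot _))
  obtain ⟨k, ⟨idx⟩⟩ := Finite.exists_equiv_fin F.Component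
  choose i j hij hget using fun v => List.exists_lt_get_of_count_eq_two (C.count_visits hF v)
  -- Lexicographic order by component and then by place in its circuit: the word is the
  -- concatenation of the circuits.
  let f : V × Bool → Fin k ×ₗ ℕ := fun y =>
    toLex (idx (F.component y.1), if y.2 then (j y.1 : ℕ) else i y.1)
  have hsame : ∀ u v, u ≠ v → F.component u = F.component v →
      ((i u : ℕ) ≠ i v ∧ (i u : ℕ) ≠ j v) ∧ ((j u : ℕ) ≠ i v ∧ (j u : ℕ) ≠ j v) := by
    intro u v huv hc
    have hu := hget u
    have hv := hget v
    -- The indices belong to `Fin` types that depend on the component; they are generalized so that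
    -- the equality `hc` of components can be rewritten.
    revert hu hv
    generalize i u = a, j u = b, i v = a', j v = b'
    revert a b
    rw [hc]
    intro a b hu hv
    have key : ∀ x y, (x = a ∨ x = b) → (y = a' ∨ y = b') → (x : ℕ) ≠ y := by
      intro x y hx hy he
      obtain rfl := Fin.ext he
      exact huv (((hu x).2 hx).symm.trans ((hv x).2 hy))
    exact ⟨⟨key _ _ (.inl rfl) (.inl rfl), key _ _ (.inl rfl) (.inr rfl)⟩,
      key _ _ (.inr rfl) (.inl rfl), key _ _ (.inr rfl) (.inr rfl)⟩
  have hf : f.Injective := by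
    rintro ⟨u, b⟩ ⟨v, b'⟩ h
    have h' := toLex.injective h
    simp only [Prod.mk.injEq] at h'
    have hc := idx.injective h'.1
    have huv : u = v := by
      by_contra huv
      have := hsame u v huv hc
      have h2 := h'.2
      split_ifs at h2 <;> omega
    subst huv
    have h2 := h'.2
    have hne : (i u : ℕ) ≠ j u := (Fin.lt_def.1 (hij u)).ne
    cases b <;> cases b' <;> first | rfl | exact absurd h2 hne | exact absurd h2 hne.symm
  obtain ⟨e, he⟩ := exists_equiv_fin_lt_iff hf
  have hflt : ∀ u v b b', f (u, b) < f (v, b') ↔ idx (F.component u) < idx (F.component v) ∨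
      (idx (F.component u) = idx (F.component v) ∧
        (if b then (j u : ℕ) else i u) < (if b' then (j v : ℕ) else i v)) := by
    intro u v b b'
    rw [Prod.Lex.lt_iff]
    rfl
  let D : DoubleOccurrenceWord V := ⟨e, fun v => by
    rw [he, hflt]
    exact Or.inr ⟨rfl, by simpa using hij v⟩⟩
  have halt : ∀ u v, F.component u = F.component v →
      ([u, v, u, v].Sublist (F.visits (C.circuit (F.component u))) ↔
        (i u : ℕ) < i v ∧ (i v : ℕ) < j u ∧ (j u : ℕ) < j v) := by
    intro u v hc
    have hu := hget u
    have hv := hget v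
    have hu' := hij u
    have hv' := hij v
    revert hu hv hu' hv'
    generalize i u = a, j u = b, i v = a', j v = b'
    revert a b
    rw [hc]
    intro a b hu hv hu' hv'
    exact List.sublist_alternating_iff hu' hv' hu hv
  have hD : ∀ u v, (D.pos (u, false) < D.pos (v, false) ∧ D.pos (v, false) < D.pos (u, true) ∧
      D.pos (u, true) < D.pos (v, true)) ↔ F.component u = F.component v ∧
        (i u : ℕ) < i v ∧ (i v : ℕ) < j u ∧ (j u : ℕ) < j v := by
    intro u v
    change (e _ < e _ ∧ e _ < e _ ∧ e _ < e _) ↔ _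
    simp only [he, hflt, ← idx.injective.eq_iff (a := F.component u), if_true, Bool.false_eq_true,
      if_false, Fin.lt_def, Fin.ext_iff]
    -- Alternation gives `idx (F.component u) ≤ idx (F.component v) ≤ idx (F.component u)`, so
    -- letters of different components never alternate.
    omega
  refine ⟨D, fun u v => ?_⟩
  rw [Interlaced, DoubleOccurrenceWord.Alternates, hD, hD]
  constructor
  · rintro ⟨-, hc, h | h⟩
    · exact Or.inl ⟨hc, (halt u v hc).1 h⟩
    · exact Or.inr ⟨hc.symm, (halt v u hc.symm).1 (hc ▸ h)⟩
  · rintro (⟨hc, h⟩ | ⟨hc, h⟩)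
    · refine ⟨?_, hc, Or.inl ((halt u v hc).2 h)⟩
      rintro rfl
      exact lt_irrefl _ h.1
    · refine ⟨?_, hc.symm, Or.inr (hc ▸ (halt v u hc).2 h)⟩
      rintro rfl
      exact lt_irrefl _ h.1

end HalfEdgeGraph

theorem mainTheorem2 {V : Type*} [Fintype V] [DecidableEq V] (G : SimpleGraph V)
    [DecidableRel G.Adj] (hG : IsCircleGraph G) :
    ∃ (m : ℕ) (A : Matrix (Fin m) (V ⊕ V ⊕ V) ℚ),
      (Z₃ G).IsStrictRepresentation A ∧ (Z₃ G).IsTotallyTransversallyUnimodular A := by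
  obtain ⟨H, _, F, C, hF, hC⟩ := hG
  obtain ⟨D, hD⟩ := C.exists_alternates_iff hF
  exact D.exists_strict_representation G fun u v => (hC u v).trans (hD u v)
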